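/- Let $n\ge 1$ and let $\pi\in\mathfrak S_n$ be any permutation of $[n]=\{1,\dots,n\}$, with $m$ cycles (fixed points counted as cycles of length $1$) of lengths $\ell_1,\dots,\ell_m$. A star factorization of $\pi$ of length $r$ is an ordered list $(\tau_1,\dots,\tau_r)$ of star transpositions, that is, transpositions of the form $(1\,i)$ with $2\le i\le n$, such that $\tau_1\cdots\tau_r=\pi$. It is transitive if the group generated by $\tau_1,\dots,\tau_r$ acts transitively on $[n]$, and it is called minimal transitive if it is transitive and $r=n+m-2$. Then the number of minimal transitive star factorizations of $\pi$ is exactly $$\frac{(n+m-2)!}{n!}\,\ell_1\cdots\ell_m .$$ -/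

import Mathlib

namespace StarFactorization

/-- A star transposition: `(1 i)` with `i ≠ 1`. The symbols `1, …, n` are represented by `Fin n`,
so that the distinguished symbol `1` is `0 : Fin n`. -/
def IsStarTransposition {n : ℕ} [NeZero n] (τ : Equiv.Perm (Fin n)) : Prop :=
  ∃ i : Fin n, i ≠ 0 ∧ τ = Equiv.swap 0 i

/-- A star factorization of `π`: an ordered list of star transpositions with product `π`. -/
def IsStarFactorization {n : ℕ} [NeZero n] (π : Equiv.Perm (Fin n))
    (f : List (Equiv.Perm (Fin n))) : Prop :=
  (∀ τ ∈ f, IsStarTransposition τ) ∧ f.prod = π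

/-- A list of permutations is transitive if the group generated by its members
acts transitively on the set of all symbols. -/
def IsTransitive {n : ℕ} (f : List (Equiv.Perm (Fin n))) : Prop :=
  MulAction.IsPretransitive (Subgroup.closure {τ : Equiv.Perm (Fin n) | τ ∈ f}) (Fin n)

/-- The multiset of the lengths of all cycles of `π`, fixed points counted as cycles of length 1. -/
def cycleLengths {n : ℕ} (π : Equiv.Perm (Fin n)) : Multiset ℕ :=
  π.partition.parts

/-- The number of cycles of `π`, fixed points included. -/
def numCycles {n : ℕ} (π : Equiv.Perm (Fin n)) : ℕ :=
  (cycleLengths π).card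

/-- A minimal transitive star factorization of `π`: a transitive star factorization of
length `n + m - 2`, where `m` is the number of cycles of `π`. Here `n, m ≥ 1`, so the
subtraction does not truncate. -/
def IsMinimalTransitive {n : ℕ} [NeZero n] (π : Equiv.Perm (Fin n))
    (f : List (Equiv.Perm (Fin n))) : Prop :=
  IsStarFactorization π f ∧ IsTransitive f ∧ f.length = n + numCycles π - 2

end StarFactorization

namespace StarFactorization

/-! A star factorization is a word in the letters `i ≠ 0`, and it is transitive exactly when every
such letter occurs (`isTransitive_map_swap_iff`). The count of words is proved by induction on the
length, for an arbitrary set `S` of letters, since deleting the first letter `i` may remove `i` from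
the letter set.

Write `N` for the number of symbols, `s = |S|`, `c` for the number of cycles of `π` and `k` for the
length of the cycle of `a`; the length is `r + 1 = 2s + c - N`, the least that
`two_mul_card_toFinset_add_card_cycles_le` permits. After deletion of `i` the product is `(a i) π`.
If `i` still occurs, it must lie outside the cycle of `a`: otherwise the remaining word is too
short. The two cycles then merge, which contributes the factor `1/ℓ + 1/k`, with `ℓ` the length of
the cycle of `i`. If `i` no longer occurs, `(a i) π` fixes `i`, so `i = π⁻¹ a`, which contributes
`(s + 1)(k - 1)/k`. Since reciprocal cycle lengths sum to `1` over each cycle, the contributions add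
up to `(c + s - N) + (s + 1 - k)/k + (s + 1)(k - 1)/k = r + 1`, and this is the step from `r!` to
`(r + 1)!` (`card_words_mul_factorial`). -/

lemma sameCycle_swap_apply {α : Type*} [DecidableEq α] {σ : Equiv.Perm α} {a i : α}
    (hai : σ.SameCycle a i) {x y : α} (h : σ.SameCycle x y) : σ.SameCycle x (Equiv.swap a i y) := by
  rcases eq_or_ne y a with rfl | hya
  · simpa using h.trans hai
  rcases eq_or_ne y i with rfl | hyi
  · simpa using h.trans hai.symm
  · rwa [Equiv.swap_apply_of_ne_of_ne hya hyi]

/-- If every step of `π` stays within a class of `σ`, the cycles of `π` refine those of `σ`. -/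
lemma sameCycle_of_forall_apply {α : Type*} [Finite α] {π σ : Equiv.Perm α}
    (h : ∀ x, σ.SameCycle x (π x)) {x y : α} (hxy : π.SameCycle x y) : σ.SameCycle x y := by
  obtain ⟨k, rfl⟩ := hxy.exists_nat_pow_eq
  induction k with
  | zero => exact .refl σ x
  | succ k ih =>
    rw [pow_succ', Equiv.Perm.mul_apply]
    exact (ih ⟨k, by simp⟩).trans (h _)

/-! ### Cycles as sets, and the effect of a transposition on them -/

section Cycles

variable {α : Type*} [Fintype α] [DecidableEq α]

/-- The cycle of `π` through `x`, as a set of symbols. -/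
def cycleThrough (π : Equiv.Perm α) (x : α) : Finset α :=
  Finset.univ.filter (π.SameCycle x)

/-- The cycles of `π`, fixed points included, as sets of symbols. -/
def cycles (π : Equiv.Perm α) : Finset (Finset α) :=
  Finset.univ.image (cycleThrough π)

lemma mem_cycleThrough {π : Equiv.Perm α} {x y : α} :
    y ∈ cycleThrough π x ↔ π.SameCycle x y := by
  simp [cycleThrough]

lemma self_mem_cycleThrough (π : Equiv.Perm α) (x : α) : x ∈ cycleThrough π x :=
  mem_cycleThrough.2 (Equiv.Perm.SameCycle.refl π x)

lemma cycleThrough_mem_cycles (π : Equiv.Perm α) (x : α) : cycleThrough π x ∈ cycles π :=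
  Finset.mem_image_of_mem _ (Finset.mem_univ x)

lemma cycleThrough_eq_iff {π : Equiv.Perm α} {x y : α} :
    cycleThrough π x = cycleThrough π y ↔ π.SameCycle x y := by
  constructor
  · intro h
    exact mem_cycleThrough.1 (h ▸ self_mem_cycleThrough π y)
  · intro h
    ext z
    simp only [mem_cycleThrough]
    exact ⟨h.symm.trans, h.trans⟩

lemma cycleThrough_eq_of_mem {π : Equiv.Perm α} {c : Finset α} (hc : c ∈ cycles π) {x : α}
    (hx : x ∈ c) : cycleThrough π x = c := by
  obtain ⟨y, -, rfl⟩ := Finset.mem_image.1 hc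
  exact cycleThrough_eq_iff.2 (mem_cycleThrough.1 hx).symm

lemma card_cycleThrough_pos (π : Equiv.Perm α) (x : α) : 0 < (cycleThrough π x).card :=
  Finset.card_pos.2 ⟨x, self_mem_cycleThrough π x⟩

lemma cycleThrough_eq_singleton {π : Equiv.Perm α} {x : α} (h : π x = x) :
    cycleThrough π x = {x} := by
  ext y
  rw [mem_cycleThrough, Finset.mem_singleton]
  constructor
  · intro hy
    exact (hy.eq_of_left h).symm
  · rintro rfl
    exact Equiv.Perm.SameCycle.refl _ _

lemma sum_inv_card_of_mem_cycles {π : Equiv.Perm α} {c : Finset α} (hc : c ∈ cycles π) :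
    ∑ x ∈ c, ((cycleThrough π x).card : ℚ)⁻¹ = 1 := by
  have hne : (c.card : ℚ) ≠ 0 := by
    obtain ⟨y, -, rfl⟩ := Finset.mem_image.1 hc
    exact_mod_cast (card_cycleThrough_pos π y).ne'
  rw [Finset.sum_congr rfl fun x hx => by rw [cycleThrough_eq_of_mem hc hx]]
  simp [hne]

/-- Each cycle has total weight `1` when a symbol is weighted by the reciprocal of its cycle length.
-/
lemma sum_inv_card_cycleThrough (π : Equiv.Perm α) :
    ∑ x, ((cycleThrough π x).card : ℚ)⁻¹ = (cycles π).card := by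
  rw [← Finset.sum_fiberwise_of_maps_to (t := cycles π) (g := cycleThrough π)
    fun x _ => cycleThrough_mem_cycles π x]
  rw [Finset.card_eq_sum_ones, Nat.cast_sum]
  refine Finset.sum_congr rfl fun c hc => ?_
  have : Finset.univ.filter (fun x => cycleThrough π x = c) = c := by
    ext x
    simp only [Finset.mem_filter, Finset.mem_univ, true_and]
    exact ⟨fun h => h ▸ self_mem_cycleThrough π x, cycleThrough_eq_of_mem hc⟩
  rw [this, sum_inv_card_of_mem_cycles hc, Nat.cast_one]

/-- The cycles of `π` refine those of `σ`, so every reciprocal weight for `σ` is at most the one for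
`π`. -/
lemma card_cycles_le_of_forall_apply {π σ : Equiv.Perm α} (h : ∀ x, σ.SameCycle x (π x)) :
    (cycles σ).card ≤ (cycles π).card := by
  have : ((cycles σ).card : ℚ) ≤ (cycles π).card := by
    rw [← sum_inv_card_cycleThrough, ← sum_inv_card_cycleThrough]
    refine Finset.sum_le_sum fun x _ => ?_
    have hpos := card_cycleThrough_pos π x
    gcongr
    intro y
    simp only [mem_cycleThrough]
    exact sameCycle_of_forall_apply h
  exact_mod_cast this

lemma card_cycles_le_card_cycles_swap_mul {π : Equiv.Perm α} {a i : α}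
    (h : π.SameCycle a i) : (cycles π).card ≤ (cycles (Equiv.swap a i * π)).card :=
  card_cycles_le_of_forall_apply fun x =>
    sameCycle_swap_apply h (Equiv.Perm.sameCycle_apply_right.2 (.refl π x))

lemma cycleThrough_subset_of_forall_apply {σ : Equiv.Perm α} {T : Finset α}
    (hT : ∀ x ∈ T, σ x ∈ T) {x : α} (hx : x ∈ T) : cycleThrough σ x ⊆ T := by
  intro y hy
  obtain ⟨k, rfl⟩ := (mem_cycleThrough.1 hy).exists_nat_pow_eq
  clear hy
  induction k with
  | zero => exact hx
  | succ k ih =>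
    rw [pow_succ', Equiv.Perm.mul_apply]
    exact hT _ ih

/-- Starting from `a`, `σ` follows the cycle of `π` until the latter returns to `a`. Hence `π⁻¹ a`
lies in the `σ`-cycle of `a`, and `σ` sends it to `i`. -/
lemma sameCycle_swap_mul {π : Equiv.Perm α} {a i : α} (h : ¬ π.SameCycle a i) :
    (Equiv.swap a i * π).SameCycle a i := by
  set σ := Equiv.swap a i * π with hσ
  -- The intersection is closed under `π`; at the return to `a` there is nothing to check.
  have hsub : cycleThrough π a ⊆ cycleThrough π a ∩ cycleThrough σ a := by
    refine cycleThrough_subset_of_forall_apply (fun x hx => ?_)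
      (Finset.mem_inter.2 ⟨self_mem_cycleThrough _ _, self_mem_cycleThrough _ _⟩)
    obtain ⟨hπ, hσx⟩ := Finset.mem_inter.1 hx
    rw [mem_cycleThrough] at hπ hσx
    have hπ' : π.SameCycle a (π x) := Equiv.Perm.sameCycle_apply_right.2 hπ
    rw [Finset.mem_inter, mem_cycleThrough, mem_cycleThrough]
    refine ⟨hπ', ?_⟩
    by_cases hxa : π x = a
    · rw [hxa]
    have hxi : π x ≠ i := fun hxi => h (hxi ▸ hπ')
    have : σ x = π x := by
      rw [hσ, Equiv.Perm.mul_apply, Equiv.swap_apply_of_ne_of_ne hxa hxi]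
    rw [← this]
    exact Equiv.Perm.sameCycle_apply_right.2 hσx
  have hmem : π⁻¹ a ∈ cycleThrough π a :=
    mem_cycleThrough.2 (Equiv.Perm.SameCycle.symm ⟨1, by simp⟩)
  have := Equiv.Perm.sameCycle_apply_right.2
    (mem_cycleThrough.1 (Finset.mem_inter.1 (hsub hmem)).2)
  simpa [hσ] using this

lemma cycleThrough_swap_mul_self {π : Equiv.Perm α} {a i : α} (h : ¬ π.SameCycle a i) :
    cycleThrough (Equiv.swap a i * π) a = cycleThrough π a ∪ cycleThrough π i := by
  have hσ := sameCycle_swap_mul h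
  have hπσ : ∀ {x y}, π.SameCycle x y → (Equiv.swap a i * π).SameCycle x y := by
    refine sameCycle_of_forall_apply fun x => ?_
    have := sameCycle_swap_apply hσ
      (Equiv.Perm.sameCycle_apply_right.2 (.refl (Equiv.swap a i * π) x))
    simpa using this
  apply Finset.Subset.antisymm
  · refine cycleThrough_subset_of_forall_apply (fun x hx => ?_)
      (Finset.mem_union_left _ (self_mem_cycleThrough π a))
    have hx' : π x ∈ cycleThrough π a ∪ cycleThrough π i := by
      simpa [mem_cycleThrough] using hx
    rw [Equiv.Perm.mul_apply, Equiv.swap_apply_def]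
    split_ifs
    · exact Finset.mem_union_right _ (self_mem_cycleThrough π i)
    · exact Finset.mem_union_left _ (self_mem_cycleThrough π a)
    · exact hx'
  · intro x hx
    simp only [Finset.mem_union, mem_cycleThrough] at hx ⊢
    rcases hx with hx | hx
    · exact hπσ hx
    · exact hσ.trans (hπσ hx)

lemma cycleThrough_swap_mul_of_not_mem {π : Equiv.Perm α} {a i x : α}
    (ha : ¬ π.SameCycle a x) (hi : ¬ π.SameCycle i x) :
    cycleThrough (Equiv.swap a i * π) x = cycleThrough π x := by
  have hstep : ∀ {y}, π.SameCycle x y → (Equiv.swap a i * π) y = π y := fun {y} hy => by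
    have hy' : π.SameCycle x (π y) := Equiv.Perm.sameCycle_apply_right.2 hy
    rw [Equiv.Perm.mul_apply, Equiv.swap_apply_of_ne_of_ne]
    · intro e
      exact ha (e ▸ hy'.symm)
    · intro e
      exact hi (e ▸ hy'.symm)
  apply Finset.Subset.antisymm
  · refine cycleThrough_subset_of_forall_apply (fun y hy => ?_) (self_mem_cycleThrough π x)
    rw [mem_cycleThrough] at hy ⊢
    rw [hstep hy]
    exact Equiv.Perm.sameCycle_apply_right.2 hy
  · refine (cycleThrough_subset_of_forall_apply
      (T := cycleThrough π x ∩ cycleThrough (Equiv.swap a i * π) x) (fun y hy => ?_)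
      (Finset.mem_inter.2 ⟨self_mem_cycleThrough _ _, self_mem_cycleThrough _ _⟩)).trans
      Finset.inter_subset_right
    simp only [Finset.mem_inter, mem_cycleThrough] at hy ⊢
    refine ⟨Equiv.Perm.sameCycle_apply_right.2 hy.1, ?_⟩
    rw [← hstep hy.1]
    exact Equiv.Perm.sameCycle_apply_right.2 hy.2

lemma cycles_swap_mul {π : Equiv.Perm α} {a i : α} (h : ¬ π.SameCycle a i) :
    cycles (Equiv.swap a i * π) = insert (cycleThrough π a ∪ cycleThrough π i)
      (((cycles π).erase (cycleThrough π a)).erase (cycleThrough π i)) := by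
  have hσ := sameCycle_swap_mul h
  have hself := cycleThrough_swap_mul_self h
  have hcases : ∀ x, ¬ (¬ π.SameCycle a x ∧ ¬ π.SameCycle i x) →
      cycleThrough (Equiv.swap a i * π) x = cycleThrough π a ∪ cycleThrough π i := by
    intro x hx
    rw [← hself]
    refine cycleThrough_eq_of_mem (cycleThrough_mem_cycles _ _) ?_
    rw [hself, Finset.mem_union, mem_cycleThrough, mem_cycleThrough]
    tauto
  ext c
  rw [Finset.mem_insert, Finset.mem_erase, Finset.mem_erase]
  constructor
  · intro hc
    obtain ⟨x, -, rfl⟩ := Finset.mem_image.1 hc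
    by_cases hx : ¬ π.SameCycle a x ∧ ¬ π.SameCycle i x
    · right
      rw [cycleThrough_swap_mul_of_not_mem hx.1 hx.2]
      exact ⟨fun e => hx.2 (cycleThrough_eq_iff.1 e.symm),
        fun e => hx.1 (cycleThrough_eq_iff.1 e.symm), cycleThrough_mem_cycles _ _⟩
    · exact .inl (hcases x hx)
  · rintro (rfl | ⟨hi, ha, hc⟩)
    · rw [← hself]
      exact cycleThrough_mem_cycles _ _
    · obtain ⟨x, -, rfl⟩ := Finset.mem_image.1 hc
      rw [← cycleThrough_swap_mul_of_not_mem (a := a) (i := i)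
        (fun e => ha (cycleThrough_eq_iff.2 e.symm)) (fun e => hi (cycleThrough_eq_iff.2 e.symm))]
      exact cycleThrough_mem_cycles _ _

lemma disjoint_cycleThrough {π : Equiv.Perm α} {a i : α} (h : ¬ π.SameCycle a i) :
    Disjoint (cycleThrough π a) (cycleThrough π i) := by
  rw [Finset.disjoint_left]
  intro x ha hi
  exact h ((mem_cycleThrough.1 ha).trans (mem_cycleThrough.1 hi).symm)

lemma union_not_mem_cycles {π : Equiv.Perm α} {a i : α} (h : ¬ π.SameCycle a i) :
    cycleThrough π a ∪ cycleThrough π i ∉ cycles π := by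
  intro hc
  have := cycleThrough_eq_of_mem hc (Finset.mem_union_left _ (self_mem_cycleThrough π a))
  refine h (mem_cycleThrough.1 ?_)
  rw [this]
  exact Finset.mem_union_right _ (self_mem_cycleThrough π i)

lemma card_cycleThrough_swap_mul_self {π : Equiv.Perm α} {a i : α} (h : ¬ π.SameCycle a i) :
    (cycleThrough (Equiv.swap a i * π) a).card =
      (cycleThrough π a).card + (cycleThrough π i).card := by
  rw [cycleThrough_swap_mul_self h, Finset.card_union_of_disjoint (disjoint_cycleThrough h)]

lemma card_cycles_swap_mul {π : Equiv.Perm α} {a i : α} (h : ¬ π.SameCycle a i) :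
    (cycles (Equiv.swap a i * π)).card + 1 = (cycles π).card := by
  have hi : cycleThrough π i ∈ (cycles π).erase (cycleThrough π a) :=
    Finset.mem_erase.2 ⟨fun e => h (cycleThrough_eq_iff.1 e.symm), cycleThrough_mem_cycles _ _⟩
  have hu := union_not_mem_cycles h
  rw [cycles_swap_mul h, Finset.card_insert_of_notMem fun hmem =>
    hu (Finset.mem_of_mem_erase (Finset.mem_of_mem_erase hmem)),
    Finset.card_erase_add_one hi, Finset.card_erase_add_one (cycleThrough_mem_cycles _ _)]

/-- The product of the cycle lengths of `π`. -/
def cycleProd (π : Equiv.Perm α) : ℕ := ∏ c ∈ cycles π, c.card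

/-- Merging replaces two factors by their sum; cross-multiplication avoids division in `ℕ`. -/
lemma cycleProd_swap_mul {π : Equiv.Perm α} {a i : α} (h : ¬ π.SameCycle a i) :
    cycleProd (Equiv.swap a i * π) * ((cycleThrough π a).card * (cycleThrough π i).card) =
      cycleProd π * ((cycleThrough π a).card + (cycleThrough π i).card) := by
  have hi : cycleThrough π i ∈ (cycles π).erase (cycleThrough π a) :=
    Finset.mem_erase.2 ⟨fun e => h (cycleThrough_eq_iff.1 e.symm), cycleThrough_mem_cycles _ _⟩
  have hu := union_not_mem_cycles h
  rw [cycleProd, cycleProd, cycles_swap_mul h, Finset.prod_insert fun hmem =>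
    hu (Finset.mem_of_mem_erase (Finset.mem_of_mem_erase hmem)),
    ← Finset.mul_prod_erase (cycles π) _ (cycleThrough_mem_cycles π a),
    ← Finset.mul_prod_erase _ _ hi, Finset.card_union_of_disjoint (disjoint_cycleThrough h)]
  ring

/-- Multiplying again by `(a i)` recovers `π`, and a transposition loses at most one cycle by
merging. -/
lemma card_cycles_swap_mul_le (π : Equiv.Perm α) (a i : α) :
    (cycles (Equiv.swap a i * π)).card ≤ (cycles π).card + 1 := by
  by_cases h : (Equiv.swap a i * π).SameCycle a i
  · have := card_cycles_le_card_cycles_swap_mul h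
    rw [Equiv.swap_mul_self_mul] at this
    omega
  · have := card_cycles_swap_mul h
    rw [Equiv.swap_mul_self_mul] at this
    omega

/-- Nontrivial cycles are the supports of the cycle factors, and fixed points are the singletons;
these are the two summands of `partition`. -/
lemma cycles_val_map_card (π : Equiv.Perm α) :
    (cycles π).val.map Finset.card = π.partition.parts := by
  have hcyc : cycles π = (π.cycleFactorsFinset.image Equiv.Perm.support) ∪
      ((Finset.univ \ π.support).image fun x => {x}) := by
    ext c
    simp only [Finset.mem_union, Finset.mem_image, Finset.mem_sdiff, Finset.mem_univ, true_and,
      Equiv.Perm.notMem_support]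
    have hsupp : ∀ x ∈ π.support, (π.cycleOf x).support = cycleThrough π x := fun x hx => by
      ext y
      rw [Equiv.Perm.mem_support_cycleOf_iff, mem_cycleThrough, and_iff_left hx]
    constructor
    · intro hc
      obtain ⟨x, -, rfl⟩ := Finset.mem_image.1 hc
      by_cases hx : π x = x
      · exact .inr ⟨x, hx, (cycleThrough_eq_singleton hx).symm⟩
      · exact .inl ⟨π.cycleOf x, Equiv.Perm.cycleOf_mem_cycleFactorsFinset_iff.2
          (Equiv.Perm.mem_support.2 hx), hsupp x (Equiv.Perm.mem_support.2 hx)⟩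
    · rintro (⟨p, hp, rfl⟩ | ⟨x, hx, rfl⟩)
      · obtain ⟨x, hx⟩ := (Equiv.Perm.mem_cycleFactorsFinset_iff.1 hp).1.nonempty_support
        have hpx := (Equiv.Perm.eq_cycleOf_of_mem_cycleFactorsFinset_iff π p hp x).2 hx
        rw [hpx, hsupp x (Equiv.Perm.mem_cycleFactorsFinset_support_le hp hx)]
        exact cycleThrough_mem_cycles _ _
      · rw [← cycleThrough_eq_singleton hx]
        exact cycleThrough_mem_cycles _ _
  have hdisj : Disjoint (π.cycleFactorsFinset.image Equiv.Perm.support)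
      ((Finset.univ \ π.support).image fun x => {x}) := by
    rw [Finset.disjoint_left]
    intro c hc hc'
    obtain ⟨p, hp, rfl⟩ := Finset.mem_image.1 hc
    obtain ⟨x, -, hx⟩ := Finset.mem_image.1 hc'
    have := (Equiv.Perm.mem_cycleFactorsFinset_iff.1 hp).1.two_le_card_support
    rw [← hx, Finset.card_singleton] at this
    omega
  have hinj : Set.InjOn Equiv.Perm.support (π.cycleFactorsFinset : Set (Equiv.Perm α)) := by
    intro p hp q hq hpq
    obtain ⟨x, hx⟩ := (Equiv.Perm.mem_cycleFactorsFinset_iff.1 hp).1.nonempty_support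
    rw [(Equiv.Perm.eq_cycleOf_of_mem_cycleFactorsFinset_iff π p hp x).2 hx,
      (Equiv.Perm.eq_cycleOf_of_mem_cycleFactorsFinset_iff π q hq x).2 (hpq ▸ hx)]
  rw [Equiv.Perm.parts_partition, Equiv.Perm.cycleType_def, hcyc,
    ← Finset.disjUnion_eq_union _ _ hdisj, Finset.disjUnion_val, Multiset.map_add,
    Finset.image_val_of_injOn hinj, Finset.image_val_of_injOn
      (Finset.singleton_injective.injOn), Multiset.map_map, Multiset.map_map]
  congr 1
  have hcard : (Finset.univ \ π.support).card = Fintype.card α - π.support.card :=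
    Finset.card_univ_sdiff _
  rw [← hcard]
  exact (Multiset.map_const _ _)

end Cycles
lemma not_sameCycle_of_apply_eq {α : Type*} {π : Equiv.Perm α} {a i : α} (hi : π i = i) (hia : i ≠ a) :
    ¬ π.SameCycle a i := fun h => hia (h.eq_of_right hi).symm

/-! ### Counting words with a prescribed letter set -/

section Words

variable {α : Type*} [DecidableEq α]

/-- The words of length `r` whose set of letters is `S` and for which the product of the
transpositions `(a i)`, for `i` running through the letters, is `π`. -/
def words [Fintype α] (a : α) : ℕ → Finset α → Equiv.Perm α → Finset (List α)
  | 0, S, π => if S = ∅ ∧ π = 1 then {[]} else ∅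
  -- The two sets of tails correspond to whether the first letter occurs again.
  | r + 1, S, π => S.biUnion fun i =>
      (words a r S (Equiv.swap a i * π) ∪ words a r (S.erase i) (Equiv.swap a i * π)).image
        (List.cons i)

lemma mem_words [Fintype α] {a : α} {r : ℕ} {S : Finset α} {π : Equiv.Perm α} {w : List α} :
    w ∈ words a r S π ↔
      w.length = r ∧ w.toFinset = S ∧ (w.map (Equiv.swap a)).prod = π := by
  induction r generalizing S π w with
  | zero =>
    rw [words]
    constructor
    · intro h
      split_ifs at h with hS
      · rw [Finset.mem_singleton] at h
        subst h
        exact ⟨rfl, hS.1.symm, hS.2.symm⟩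
      · simp at h
    · rintro ⟨hl, rfl, rfl⟩
      rw [List.length_eq_zero_iff] at hl
      subst hl
      simp
  | succ r ih =>
    have hprod : ∀ (i : α) (w : List α), (w.map (Equiv.swap a)).prod = Equiv.swap a i * π ↔
        Equiv.swap a i * (w.map (Equiv.swap a)).prod = π := fun i w => by
      rw [← Equiv.swap_inv, eq_inv_mul_iff_mul_eq, Equiv.swap_inv]
    rw [words]
    simp only [Finset.mem_biUnion, Finset.mem_image, Finset.mem_union, ih, hprod]
    constructor
    · rintro ⟨i, hi, v, ⟨hl, hv, hp⟩ | ⟨hl, hv, hp⟩, rfl⟩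
      · exact ⟨by simp [hl], by simp [hv, hi], by simpa using hp⟩
      · exact ⟨by simp [hl], by simp [hv, hi], by simpa using hp⟩
    · rintro ⟨hl, hS, hp⟩
      obtain _ | ⟨i, v⟩ := w
      · simp at hl
      rw [List.toFinset_cons] at hS
      rw [List.map_cons, List.prod_cons] at hp
      refine ⟨i, hS ▸ Finset.mem_insert_self _ _, v, ?_, rfl⟩
      have hl' : v.length = r := by simpa using hl
      by_cases hi : i ∈ v.toFinset
      · exact .inl ⟨hl', by rw [← hS, Finset.insert_eq_of_mem hi], hp⟩
      · exact .inr ⟨hl', by rw [← hS, Finset.erase_insert hi], hp⟩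

lemma card_words_succ [Fintype α] (a : α) (r : ℕ) (S : Finset α) (π : Equiv.Perm α) :
    (words a (r + 1) S π).card = ∑ i ∈ S, ((words a r S (Equiv.swap a i * π)).card +
      (words a r (S.erase i) (Equiv.swap a i * π)).card) := by
  rw [words, Finset.card_biUnion]
  · refine Finset.sum_congr rfl fun i hi => ?_
    rw [Finset.card_image_of_injective _ List.cons_injective, Finset.card_union_of_disjoint]
    rw [Finset.disjoint_left]
    intro w hw hw'
    have h := (mem_words.1 hw).2.1.symm.trans (mem_words.1 hw').2.1
    exact Finset.notMem_erase i S (h ▸ hi)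
  · intro i _ j _ hij
    rw [Function.onFun, Finset.disjoint_left]
    intro w hw hw'
    obtain ⟨v, -, rfl⟩ := Finset.mem_image.1 hw
    obtain ⟨u, -, hu⟩ := Finset.mem_image.1 hw'
    exact hij (List.cons.inj hu).1.symm

lemma prod_map_swap_apply_of_not_mem {a x : α} (hx : x ≠ a) {w : List α} (hw : x ∉ w) :
    (w.map (Equiv.swap a)).prod x = x := by
  induction w with
  | nil => rfl
  | cons i w ih =>
    rw [List.mem_cons, not_or] at hw
    rw [List.map_cons, List.prod_cons, Equiv.Perm.mul_apply, ih hw.2,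
      Equiv.swap_apply_of_ne_of_ne hx hw.1]

/-- When a word is built from its end, a new letter is a fixed point that gets merged, so the left
side grows by `2 - 1`; a repeated letter adds at most one cycle. -/
lemma two_mul_card_toFinset_add_card_cycles_le [Fintype α] {a : α} {w : List α} (ha : a ∉ w) :
    2 * w.toFinset.card + (cycles (w.map (Equiv.swap a)).prod).card ≤
      w.length + Fintype.card α := by
  induction w with
  | nil => simpa [cycles] using Finset.card_image_le (s := Finset.univ) (f := cycleThrough (1 : Equiv.Perm α))
  | cons i w ih =>
    rw [List.mem_cons, not_or] at ha
    have ih := ih ha.2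
    rw [List.map_cons, List.prod_cons, List.length_cons, List.toFinset_cons]
    by_cases hi : i ∈ w.toFinset
    · rw [Finset.insert_eq_of_mem hi]
      have := card_cycles_swap_mul_le (w.map (Equiv.swap a)).prod a i
      omega
    · rw [Finset.card_insert_of_notMem hi]
      have hfix := prod_map_swap_apply_of_not_mem (Ne.symm ha.1)
        (fun h => hi (List.mem_toFinset.2 h))
      have := card_cycles_swap_mul (not_sameCycle_of_apply_eq hfix (Ne.symm ha.1))
      omega

lemma words_eq_empty_of_lt [Fintype α] {a : α} {r : ℕ} {S : Finset α} {π : Equiv.Perm α}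
    (ha : a ∉ S) (h : r + Fintype.card α < 2 * S.card + (cycles π).card) :
    words a r S π = ∅ := by
  refine Finset.eq_empty_of_forall_notMem fun w hw => ?_
  obtain ⟨rfl, rfl, rfl⟩ := mem_words.1 hw
  have := two_mul_card_toFinset_add_card_cycles_le (a := a) (w := w) (by simpa using ha)
  omega

lemma cycleThrough_subset_insert [Fintype α] {a : α} {S : Finset α} {π : Equiv.Perm α}
    (hπ : ∀ x ∉ S, x ≠ a → π x = x) : cycleThrough π a ⊆ insert a S := by
  intro x hx
  rw [Finset.mem_insert]
  by_contra! h
  exact not_sameCycle_of_apply_eq (hπ x h.2 h.1) h.1 (mem_cycleThrough.1 hx)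

/-- The total weight is the number of cycles. The cycle of `a` has weight `1`, and each symbol
outside `insert a S` is fixed and has weight `1`. -/
lemma sum_inv_card_insert [Fintype α] {a : α} {S : Finset α} {π : Equiv.Perm α} (ha : a ∉ S)
    (hπ : ∀ x ∉ S, x ≠ a → π x = x) :
    ∑ x ∈ S \ cycleThrough π a, ((cycleThrough π x).card : ℚ)⁻¹ =
      (cycles π).card + S.card - Fintype.card α := by
  have h1 := Finset.sum_sdiff (f := fun x => ((cycleThrough π x).card : ℚ)⁻¹)
    (cycleThrough_subset_insert hπ)
  have h2 := Finset.sum_sdiff (f := fun x => ((cycleThrough π x).card : ℚ)⁻¹)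
    (Finset.subset_univ (insert a S))
  have h3 : ∑ x ∈ Finset.univ \ insert a S, ((cycleThrough π x).card : ℚ)⁻¹ =
      Fintype.card α - (S.card + 1) := by
    rw [Finset.sum_congr rfl (g := fun _ => (1 : ℚ)) fun x hx => ?_, Finset.sum_const,
      nsmul_eq_mul, mul_one, Finset.card_univ_sdiff, Nat.cast_sub (Finset.card_le_univ _),
      Finset.card_insert_of_notMem ha]
    · push_cast
      rfl
    · rw [Finset.mem_sdiff, Finset.mem_insert, not_or] at hx
      rw [cycleThrough_eq_singleton (hπ x hx.2.2 hx.2.1)]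
      simp
  rw [sum_inv_card_of_mem_cycles (cycleThrough_mem_cycles π a),
    Finset.insert_sdiff_of_mem _ (self_mem_cycleThrough π a)] at h1
  rw [sum_inv_card_cycleThrough] at h2
  linarith

lemma card_sdiff_cycleThrough [Fintype α] {a : α} {S : Finset α} {π : Equiv.Perm α} (ha : a ∉ S)
    (hπ : ∀ x ∉ S, x ≠ a → π x = x) :
    ((S \ cycleThrough π a).card : ℚ) = S.card + 1 - (cycleThrough π a).card := by
  have h := Finset.card_sdiff_add_card_eq_card (cycleThrough_subset_insert hπ)
  rw [Finset.insert_sdiff_of_mem _ (self_mem_cycleThrough π a),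
    Finset.card_insert_of_notMem ha] at h
  have : ((S \ cycleThrough π a).card : ℚ) + (cycleThrough π a).card = S.card + 1 := by
    exact_mod_cast h
  linarith

lemma cycleProd_one [Fintype α] : cycleProd (1 : Equiv.Perm α) = 1 := by
  refine Finset.prod_eq_one fun c hc => ?_
  obtain ⟨x, -, rfl⟩ := Finset.mem_image.1 hc
  rw [cycleThrough_eq_singleton rfl, Finset.card_singleton]

/-- The number of words with letter set `S` of the least possible length. -/
theorem card_words_mul_factorial [Fintype α] (a : α) (r : ℕ) (S : Finset α) (π : Equiv.Perm α)
    (ha : a ∉ S) (hπ : ∀ x ∉ S, x ≠ a → π x = x)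
    (hr : r + Fintype.card α = 2 * S.card + (cycles π).card) :
    ((words a r S π).card : ℚ) * ((S.card + 1).factorial : ℚ) =
      (r.factorial : ℚ) * (cycleProd π : ℚ) := by
  induction r generalizing S π with
  | zero =>
    -- For `r = 0` the length condition turns this quantity into `-S.card`, which forces `S = ∅`.
    have hnonneg : (0 : ℚ) ≤ (cycles π).card + S.card - Fintype.card α := by
      rw [← sum_inv_card_insert ha hπ]
      positivity
    have hS : S = ∅ := by
      have : (Fintype.card α : ℚ) = 2 * S.card + (cycles π).card := by
        exact_mod_cast (zero_add (Fintype.card α) ▸ hr)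
      have h0 : (S.card : ℚ) ≤ 0 := by linarith
      exact Finset.card_eq_zero.1 (by exact_mod_cast h0.antisymm (Nat.cast_nonneg _))
    subst hS
    have h1 : π = 1 := by
      have hne : ∀ x, x ≠ a → π x = x := fun x hx => hπ x (by simp) hx
      ext x
      rw [Equiv.Perm.one_apply]
      by_cases hx : x = a
      · subst hx
        by_contra h
        exact h (π.injective (hne _ h))
      · exact hne x hx
    subst h1
    simp [words, cycleProd_one]
  | succ r ih =>
    set k := (cycleThrough π a).card with hk
    have hkpos : (0 : ℚ) < k := by exact_mod_cast card_cycleThrough_pos π a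
    set F : ℚ := r.factorial * cycleProd π with hF
    have hsame : ∀ i ∈ S, ((words a r S (Equiv.swap a i * π)).card : ℚ) * (S.card + 1).factorial =
        if i ∈ cycleThrough π a then 0 else F * (((cycleThrough π i).card : ℚ)⁻¹ + (k : ℚ)⁻¹) := by
      intro i hi
      split_ifs with hc
      -- Within the cycle of `a` no cycle is lost, so length `r` is below the minimum.
      · rw [words_eq_empty_of_lt ha]
        · simp
        · have := card_cycles_le_card_cycles_swap_mul (mem_cycleThrough.1 hc)
          omega
      · rw [mem_cycleThrough] at hc
        rw [ih S _ ha, hF]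
        · have hP : (cycleProd (Equiv.swap a i * π) : ℚ) * (k * (cycleThrough π i).card) =
              cycleProd π * (k + (cycleThrough π i).card) := by
            exact_mod_cast cycleProd_swap_mul hc
          have hipos : (0 : ℚ) < (cycleThrough π i).card := by
            exact_mod_cast card_cycleThrough_pos π i
          field_simp
          linear_combination hP
        · intro x hx hxa
          rw [Equiv.Perm.mul_apply, hπ x hx hxa,
            Equiv.swap_apply_of_ne_of_ne hxa fun e => hx (e ▸ hi)]
        · have := card_cycles_swap_mul hc
          omega
    have herase : ∀ i ∈ S, ((words a r (S.erase i) (Equiv.swap a i * π)).card : ℚ) *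
        (S.card + 1).factorial = if π⁻¹ a = i then F * (S.card + 1) * ((k - 1) / k) else 0 := by
      intro i hi
      have hia : i ≠ a := fun e => ha (e ▸ hi)
      have hcard := Finset.card_erase_add_one hi
      split_ifs with hpi
      -- The merging lemmas are applied backwards: `π` arises from `(a i) π` by joining the fixed
      -- point `i` to a cycle of length `k - 1`.
      · have hpi' : π i = a := by rw [← hpi]; simp
        have hfix : (Equiv.swap a i * π) i = i := by simp [hpi']
        have hc := not_sameCycle_of_apply_eq hfix hia
        have hmerge := card_cycles_swap_mul hc
        have hP := cycleProd_swap_mul hc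
        have hl := card_cycleThrough_swap_mul_self hc
        rw [Equiv.swap_mul_self_mul] at hmerge hP hl
        rw [cycleThrough_eq_singleton hfix, Finset.card_singleton] at hP hl
        rw [← hk] at hl
        rw [← hl, mul_one] at hP
        have hlq : ((cycleThrough (Equiv.swap a i * π) a).card : ℚ) = k - 1 := by
          rw [hl]; push_cast; ring
        have hPq : (cycleProd π : ℚ) * (k - 1) = cycleProd (Equiv.swap a i * π) * k := by
          rw [← hlq]; exact_mod_cast hP
        have := ih (S.erase i) (Equiv.swap a i * π) (fun h => ha (Finset.mem_of_mem_erase h))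
          (fun x hx hxa => ?_) (by omega)
        · rw [hcard] at this
          rw [Nat.factorial_succ, hF]
          push_cast
          field_simp
          linear_combination (k : ℚ) * this - (r.factorial : ℚ) * hPq
        · by_cases hxi : x = i
          · rw [hxi, hfix]
          · rw [Equiv.Perm.mul_apply, hπ x (fun h => hx (Finset.mem_erase.2 ⟨hxi, h⟩)) hxa,
              Equiv.swap_apply_of_ne_of_ne hxa hxi]
      · rw [Finset.eq_empty_of_forall_notMem (s := words a r (S.erase i) _) fun w hw => ?_]
        · simp
        · obtain ⟨-, hw, hp⟩ := mem_words.1 hw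
          have hfix := prod_map_swap_apply_of_not_mem hia (w := w) fun h =>
            Finset.notMem_erase i S (hw ▸ List.mem_toFinset.2 h)
          rw [hp, Equiv.Perm.mul_apply, Equiv.swap_apply_eq_iff, Equiv.swap_apply_right] at hfix
          exact hpi (by rw [← hfix]; simp)
    have hsum : ∑ i ∈ S, (if π⁻¹ a = i then F * (S.card + 1) * ((k - 1) / k) else 0) =
        F * (S.card + 1) * ((k - 1) / k) := by
      rw [Finset.sum_ite_eq]
      split_ifs with h
      · rfl
      -- If `π⁻¹ a ∉ S` then `a` is fixed, so `k = 1` and the right side vanishes too.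
      · have hfix : π a = a := by
          by_contra hne
          have h' : π⁻¹ a ≠ a := fun e => hne (by rw [Equiv.Perm.inv_eq_iff_eq] at e; exact e.symm)
          have := hπ _ h h'
          exact h' (by simpa using this.symm)
        rw [hk, cycleThrough_eq_singleton hfix]
        simp
    rw [card_words_succ, Nat.cast_sum, Finset.sum_mul]
    simp only [Nat.cast_add, add_mul]
    rw [Finset.sum_add_distrib, Finset.sum_congr rfl hsame, Finset.sum_congr rfl herase, hsum,
      Finset.sum_ite, Finset.sum_const_zero, zero_add, Finset.filter_notMem_eq_sdiff,
      ← Finset.mul_sum, Finset.sum_add_distrib, sum_inv_card_insert ha hπ, Finset.sum_const,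
      nsmul_eq_mul, card_sdiff_cycleThrough ha hπ, ← hk, Nat.factorial_succ]
    have hrq : (r : ℚ) + 1 + Fintype.card α = 2 * S.card + (cycles π).card := by
      exact_mod_cast hr
    push_cast
    rw [hF]
    field_simp
    linear_combination (-(k : ℚ) * cycleProd π) * hrq

end Words
lemma numCycles_eq_card_cycles {n : ℕ} (π : Equiv.Perm (Fin n)) : numCycles π = (cycles π).card := by
  rw [numCycles, cycleLengths, ← cycles_val_map_card, Multiset.card_map, Finset.card_val]

/-! ### From star factorizations to words -/

section Factorizations

variable {n : ℕ} [NeZero n]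

lemma swap_zero_injective : Function.Injective (Equiv.swap (0 : Fin n)) := fun i j h => by
  simpa using congrArg (fun σ : Equiv.Perm (Fin n) => σ 0) h

/-- A nonzero symbol absent from `w` is fixed by every generator; a symbol present is reached from
`0` by its own transposition. -/
lemma isTransitive_map_swap_iff {w : List (Fin n)} (hw : (0 : Fin n) ∉ w) :
    IsTransitive (w.map (Equiv.swap 0)) ↔ w.toFinset = Finset.univ.erase 0 := by
  constructor
  · intro h
    ext i
    simp only [List.mem_toFinset, Finset.mem_erase, Finset.mem_univ, and_true]
    refine ⟨fun hi e => hw (e ▸ hi), fun hi => ?_⟩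
    by_contra hiw
    obtain ⟨g, hg⟩ := h.exists_smul_eq i 0
    have hle : Subgroup.closure {τ : Equiv.Perm (Fin n) | τ ∈ w.map (Equiv.swap 0)} ≤
        MulAction.stabilizer (Equiv.Perm (Fin n)) i := by
      rw [Subgroup.closure_le]
      intro τ hτ
      obtain ⟨j, hj, rfl⟩ := List.mem_map.1 hτ
      exact Equiv.swap_apply_of_ne_of_ne hi fun e => hiw (e ▸ hj)
    exact hi ((MulAction.mem_stabilizer_iff.1 (hle g.2)).symm.trans hg)
  · intro h
    refine (MulAction.isPretransitive_iff_base (0 : Fin n)).2 fun i => ?_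
    by_cases hi : i = 0
    · exact ⟨1, by rw [one_smul, hi]⟩
    · have hiw : i ∈ w := by
        rw [← List.mem_toFinset, h]
        simpa using hi
      exact ⟨⟨Equiv.swap 0 i, Subgroup.subset_closure (List.mem_map_of_mem hiw)⟩,
        Equiv.swap_apply_left 0 i⟩

lemma exists_map_swap_of_forall_isStarTransposition {f : List (Equiv.Perm (Fin n))}
    (hf : ∀ τ ∈ f, IsStarTransposition τ) :
    ∃ w : List (Fin n), (0 : Fin n) ∉ w ∧ w.map (Equiv.swap 0) = f := by
  induction f with
  | nil => exact ⟨[], by simp, rfl⟩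
  | cons τ f ih =>
    obtain ⟨w, hw, rfl⟩ := ih fun σ hσ => hf σ (List.mem_cons_of_mem _ hσ)
    obtain ⟨i, hi, rfl⟩ := hf τ List.mem_cons_self
    exact ⟨i :: w, by simp [hw, hi.symm], rfl⟩

lemma setOf_isMinimalTransitive (π : Equiv.Perm (Fin n)) :
    {f : List (Equiv.Perm (Fin n)) | IsMinimalTransitive π f} =
      List.map (Equiv.swap 0) ''
        (words 0 (n + numCycles π - 2) (Finset.univ.erase 0) π : Set (List (Fin n))) := by
  ext f
  simp only [Set.mem_ofPred_eq, Set.mem_image, Finset.mem_coe, mem_words]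
  constructor
  · rintro ⟨⟨hf, hprod⟩, htrans, hlen⟩
    obtain ⟨w, hw, rfl⟩ := exists_map_swap_of_forall_isStarTransposition hf
    exact ⟨w, ⟨by simpa using hlen, (isTransitive_map_swap_iff hw).1 htrans, hprod⟩, rfl⟩
  · rintro ⟨w, ⟨hlen, hS, hprod⟩, rfl⟩
    have hmem : ∀ i ∈ w, i ≠ 0 := fun i hi => by
      rw [← List.mem_toFinset, hS] at hi
      exact (Finset.mem_erase.1 hi).1
    refine ⟨⟨fun τ hτ => ?_, hprod⟩, (isTransitive_map_swap_iff fun h => hmem 0 h rfl).2 hS,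
      by simpa using hlen⟩
    obtain ⟨i, hi, rfl⟩ := List.mem_map.1 hτ
    exact ⟨i, hmem i hi, rfl⟩

end Factorizations
end StarFactorization

theorem theorem1 (n : ℕ) [NeZero n] (π : Equiv.Perm (Fin n)) (m : ℕ) (ℓ : Fin m → ℕ)
    (hℓ : StarFactorization.cycleLengths π = Finset.univ.val.map ℓ) :
    ({f : List (Equiv.Perm (Fin n)) | StarFactorization.IsMinimalTransitive π f}.ncard : ℚ) =
      (Nat.factorial (n + m - 2) : ℚ) / (Nat.factorial n : ℚ) * ∏ i : Fin m, (ℓ i : ℚ) := by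
  open StarFactorization in
  have hm : numCycles π = m := by
    rw [numCycles, hℓ]
    simp
  have hprod : cycleProd π = ∏ i, ℓ i := by
    rw [cycleProd, Finset.prod_eq_multiset_prod, cycles_val_map_card, ← cycleLengths, hℓ]
    rfl
  have hn : 1 ≤ n := NeZero.one_le
  -- Together with `hn`, this keeps `n + m - 2` from truncating in the length condition.
  have hpos : 0 < (cycles π).card := Finset.card_pos.2 ⟨_, cycleThrough_mem_cycles π 0⟩
  have hS : (Finset.univ.erase (0 : Fin n)).card + 1 = n := by
    rw [Finset.card_erase_add_one (Finset.mem_univ _), Finset.card_univ, Fintype.card_fin]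
  have hmain := card_words_mul_factorial (0 : Fin n) (n + numCycles π - 2) (Finset.univ.erase 0) π
    (Finset.notMem_erase _ _) (fun x hx hx0 => (hx (by simpa using hx0)).elim)
    (by rw [numCycles_eq_card_cycles, Fintype.card_fin]; omega)
  rw [setOf_isMinimalTransitive, Set.ncard_image_of_injective _
    (List.map_injective_iff.2 swap_zero_injective), Set.ncard_coe_finset]
  rw [hS, hprod, hm] at hmain
  rw [hm, div_mul_eq_mul_div, eq_div_iff (by positivity), hmain, Nat.cast_prod]
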